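/- Equip the unit sphere $S^d\subset\mathbb{R}^{d+1}$ with its geodesic (angular) metric $d(x,y)=\arccos\langle x,y\rangle$, and $\mathbb{R}P^d=S^d/\{x\sim -x\}$ with the quotient metric, so that the distance of two points of $\mathbb{R}P^d$ is the angle between the corresponding lines. For a metric space $Y$ and $m\ge 1$ let $$p_m(Y)=\sup\{\varepsilon>0 : \text{there are } x_1,\dots,x_m\in Y \text{ with } d(x_i,x_j)\ge\varepsilon \text{ for all } i\neq j\}.$$ Let $c_n(S^d)$ be the infimum of all $t\in[0,\infty)$ such that for every continuous odd map $g\colon S^d\to\mathbb{R}^n$ there is a set $A\subset S^d$ of diameter at most $t$ with $0\in\operatorname{conv} g(A)$. Let $S^d_\delta$ denote the set of probability measures on $S^d$ whose support is finite and has diameter at most $\delta$. Let $d$ and $n$ be positive integers, and let $\delta\ge c_n(S^d)$; this condition is satisfied whenever $\delta\ge\pi-p_{n+1}(\mathbb{R}P^d)$. Then for every continuous map $f\colon S^d\to\mathbb{R}^n$ there is a set $X\subset S^d$ of diameter at most $\delta$ such that $\operatorname{conv} f(X)\cap\operatorname{conv} f(-X)\neq\emptyset$. Moreover, a point of this intersection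 has the same coefficients with respect to $X$ and $-X$: there are $y\in\operatorname{conv} f(X)\cap\operatorname{conv} f(-X)$ and $\mu\in S^d_\delta$ with support contained in $X$ such that $$\int_{S^d} f(x)\,d\mu(x)=y=\int_{S^d} f(-x)\,d\mu(x).$$ -/

import Mathlib

open scoped Pointwise

noncomputable section

namespace ProjectiveCode

/-! ### Notions for a general metric space -/

/-- A subset of a metric space has diameter at most `t`. -/
def DiamLE {X : Type*} [MetricSpace X] (A : Set X) (t : ℝ) : Prop :=
  ∀ x ∈ A, ∀ y ∈ A, dist x y ≤ t

/-- `p_m(X)`: the supremum of all `ε > 0` such that some `m` points of `X` have pairwise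
distances at least `ε`. -/
def packingDist (m : ℕ) (X : Type*) [MetricSpace X] : ℝ :=
  sSup {ε : ℝ | 0 < ε ∧ ∃ x : Fin m → X, ∀ i j, i ≠ j → ε ≤ dist (x i) (x j)}

/-- `c_n(X)`, the `ℤ/2`-Carathéodory number of a metric space `X` with involution `x ↦ -x`: the
infimum of all `t ≥ 0` such that every continuous odd map `f : X → ℝⁿ` admits a set `A ⊆ X` of
diameter at most `t` with `0 ∈ conv f(A)`. -/
def caratheodoryNumber (n : ℕ) (X : Type*) [MetricSpace X] [InvolutiveNeg X] : ℝ :=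
  sInf {t : ℝ | 0 ≤ t ∧ ∀ f : X → EuclideanSpace ℝ (Fin n), Continuous f → Function.Odd f →
    ∃ A : Set X, DiamLE A t ∧ 0 ∈ convexHull ℝ (f '' A)}

/-- The underlying set of the Vietoris–Rips metric thickening `X_δ`: the probability measures on
`X` whose support is finite and has diameter at most `δ`. -/
def thickening (X : Type*) [MetricSpace X] [MeasurableSpace X] (δ : ℝ) :
    Set (MeasureTheory.ProbabilityMeasure X) :=
  {μ | (μ : MeasureTheory.Measure X).support.Finite ∧
    DiamLE (μ : MeasureTheory.Measure X).support δ}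

/-! ### The sphere with its geodesic metric -/

/-- The unit sphere `S^d` in `ℝ^(d+1)`; it carries the geodesic (angular) metric below. -/
def GeoSphere (d : ℕ) : Type := Metric.sphere (0 : EuclideanSpace ℝ (Fin (d + 1))) 1

namespace GeoSphere

variable {d : ℕ}

/-- The unit vector in `ℝ^(d+1)` underlying a point of the sphere. -/
def toVec (x : GeoSphere d) : EuclideanSpace ℝ (Fin (d + 1)) := Subtype.val x

/-- The antipodal involution. -/
instance : InvolutiveNeg (GeoSphere d) :=
  inferInstanceAs (InvolutiveNeg (Metric.sphere (0 : EuclideanSpace ℝ (Fin (d + 1))) 1))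

theorem toVec_injective : Function.Injective (toVec : GeoSphere d → _) := Subtype.val_injective

theorem norm_toVec (x : GeoSphere d) : ‖x.toVec‖ = 1 := mem_sphere_zero_iff_norm.mp x.2

theorem toVec_neg (x : GeoSphere d) : (-x).toVec = -x.toVec := rfl

/-- The geodesic metric: the distance of `x` and `y` is the angle between them. -/
instance : MetricSpace (GeoSphere d) where
  dist x y := InnerProductGeometry.angle x.toVec y.toVec
  dist_self x := InnerProductGeometry.angle_self (by
    intro h
    have := norm_toVec x
    rw [h, norm_zero] at this
    exact zero_ne_one this)
  dist_comm x y := InnerProductGeometry.angle_comm _ _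
  dist_triangle x y z := InnerProductGeometry.angle_le_angle_add_angle _ _ _
  eq_of_dist_eq_zero := by
    intro x y h
    apply toVec_injective
    have h1 : InnerProductGeometry.angle x.toVec y.toVec = 0 := h
    have h2 : inner ℝ x.toVec y.toVec = (1 : ℝ) := by
      rw [InnerProductGeometry.inner_eq_mul_norm_of_angle_eq_zero h1, norm_toVec, norm_toVec,
        one_mul]
    exact (inner_eq_one_iff_of_norm_eq_one (norm_toVec x) (norm_toVec y)).mp h2

theorem dist_eq (x y : GeoSphere d) : dist x y = InnerProductGeometry.angle x.toVec y.toVec := rfl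

theorem dist_neg_right (x y : GeoSphere d) : dist x (-y) = Real.pi - dist x y := by
  rw [dist_eq, dist_eq, toVec_neg, InnerProductGeometry.angle_neg_right]

theorem dist_neg_left (x y : GeoSphere d) : dist (-x) y = Real.pi - dist x y := by
  rw [dist_comm, dist_neg_right, dist_comm]

instance : MeasurableSpace (GeoSphere d) := borel _

instance : BorelSpace (GeoSphere d) := ⟨rfl⟩

/-- Two points of the sphere are identified when they are equal or antipodal. -/
def antipodalSetoid (d : ℕ) : Setoid (GeoSphere d) where
  r x y := x = y ∨ x = -y
  iseqv := by
    refine ⟨fun x => Or.inl rfl, ?_, ?_⟩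
    · rintro x y (rfl | rfl)
      · exact Or.inl rfl
      · exact Or.inr (neg_neg y).symm
    · rintro x y z (rfl | rfl) (rfl | rfl)
      · exact Or.inl rfl
      · exact Or.inr rfl
      · exact Or.inr rfl
      · exact Or.inl (neg_neg z)

end GeoSphere

/-! ### Real projective space with the quotient metric -/

/-- Real projective space `ℝP^d`, the quotient of `S^d` by the antipodal action. -/
def RealProj (d : ℕ) : Type := Quotient (GeoSphere.antipodalSetoid d)

namespace RealProj

variable {d : ℕ}

/-- The distance of the classes of `x` and `y` is the minimal distance between representatives,
that is, the angle between the lines spanned by `x` and `y`. -/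
def qdist : RealProj d → RealProj d → ℝ :=
  Quotient.lift₂ (fun x y => min (dist x y) (dist x (-y))) (by
    rintro x y x' y' (rfl | rfl) (rfl | rfl) <;>
      simp only [GeoSphere.dist_neg_left, GeoSphere.dist_neg_right, sub_sub_cancel, min_comm])

/-- The quotient metric. -/
instance : MetricSpace (RealProj d) where
  dist := qdist
  dist_self := by
    rintro ⟨x⟩
    show min (dist x x) (dist x (-x)) = 0
    rw [dist_self]
    exact min_eq_left dist_nonneg
  dist_comm := by
    rintro ⟨x⟩ ⟨y⟩
    show min (dist x y) (dist x (-y)) = min (dist y x) (dist y (-x))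
    rw [GeoSphere.dist_neg_right, GeoSphere.dist_neg_right, dist_comm]
  dist_triangle := by
    rintro ⟨x⟩ ⟨y⟩ ⟨z⟩
    show min (dist x z) (dist x (-z)) ≤
      min (dist x y) (dist x (-y)) + min (dist y z) (dist y (-z))
    have h1 := dist_triangle x y z
    have h2 := dist_triangle x y (-z)
    have h3 := dist_triangle x (-y) z
    have h4 := dist_triangle x (-y) (-z)
    have e1 : dist (-y) z = dist y (-z) := by
      rw [GeoSphere.dist_neg_left, GeoSphere.dist_neg_right]
    have e2 : dist (-y) (-z) = dist y z := by
      rw [GeoSphere.dist_neg_left, GeoSphere.dist_neg_right, sub_sub_cancel]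
    rw [e1] at h3
    rw [e2] at h4
    rcases min_choice (dist x y) (dist x (-y)) with h | h <;>
      rcases min_choice (dist y z) (dist y (-z)) with h' | h' <;> rw [h, h']
    · exact (min_le_left _ _).trans h1
    · exact (min_le_right _ _).trans h2
    · exact (min_le_right _ _).trans h4
    · exact (min_le_left _ _).trans h3
  eq_of_dist_eq_zero := by
    rintro ⟨x⟩ ⟨y⟩ h
    have h0 : min (dist x y) (dist x (-y)) = 0 := h
    apply Quotient.sound
    rcases min_choice (dist x y) (dist x (-y)) with h1 | h1 <;> rw [h1] at h0
    · exact Or.inl (dist_eq_zero.mp h0)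
    · exact Or.inr (dist_eq_zero.mp h0)

end RealProj

end ProjectiveCode

end

open MeasureTheory

namespace ProjectiveCode

/-! Apply the definition of `caratheodoryNumber` to the odd map `g x = f x - f (-x)`: a convex
combination of values of `g` that vanishes says exactly that `f` has the same weighted average over
the points and over their antipodes, and the weights form the measure. The equality case `δ = c_n`
requires the infimum to be attained for each `g`. By Carathéodory's theorem `n + 1` points suffice,
so the candidates form a compact set on which the diameter is continuous
(`exists_convexCombination_dist_le_caratheodoryNumber`). For the bound by `π - p_{n+1}`, lift a
projective code to the sphere. The `n + 1` values of an odd map in `ℝⁿ` are linearly dependent, and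
replacing points by antipodes makes the coefficients nonnegative. Signed points at projective
distance at least `ε` are at angle at most `π - ε` (`GeoSphere.caratheodoryNumber_le_of_code`). -/

/-! ### Convex combinations indexed by `Fin (n + 1)` -/

/-- Carathéodory's theorem for the image of a set, with a fixed index type for the convex
combination. -/
theorem exists_fin_convexCombination_of_mem_convexHull_image {X : Type*} {n : ℕ}
    {g : X → EuclideanSpace ℝ (Fin n)} {A : Set X} {y : EuclideanSpace ℝ (Fin n)}
    (hy : y ∈ convexHull ℝ (g '' A)) :
    ∃ (x : Fin (n + 1) → X) (w : Fin (n + 1) → ℝ), (∀ i, x i ∈ A) ∧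
      w ∈ stdSimplex ℝ (Fin (n + 1)) ∧ ∑ i, w i • g (x i) = y := by
  obtain ⟨ι, _, z, w, hz, haff, hw, hw1, hwz⟩ := eq_pos_convex_span_of_mem_convexHull hy
  have hcard : Fintype.card ι ≤ n + 1 := by
    have h := haff.card_le_finrank_succ
    have h' := Submodule.finrank_le (vectorSpan ℝ (Set.range z))
    rw [finrank_euclideanSpace_fin] at h'
    omega
  have hne : Nonempty ι := by
    by_contra h
    rw [not_nonempty_iff] at h
    simp at hw1
  -- Pad to exactly `n + 1` terms: indices outside the range of `e` get weight zero and an arbitrary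
  -- point of `A`, supplied by `Function.invFun`.
  obtain ⟨e⟩ : Nonempty (ι ↪ Fin (n + 1)) :=
    Function.Embedding.nonempty_of_card_le (by simpa using hcard)
  choose x hxA hx using fun i => hz (Set.mem_range_self i)
  have hext : ∀ i, Function.extend e w (0 : Fin (n + 1) → ℝ) (e i) = w i := fun i =>
    e.injective.extend_apply w _ i
  have hext0 : ∀ j ∉ Set.range e, Function.extend e w (0 : Fin (n + 1) → ℝ) j = 0 :=
    fun j hj => Function.extend_apply' w _ j hj
  have hinv : ∀ i, Function.invFun e (e i) = i := Function.leftInverse_invFun e.injective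
  refine ⟨fun j => x (Function.invFun e j), Function.extend e w 0, fun j => hxA _, ⟨?_, ?_⟩, ?_⟩
  · intro j
    by_cases hj : j ∈ Set.range e
    · obtain ⟨i, rfl⟩ := hj
      rw [hext]
      exact (hw i).le
    · rw [hext0 j hj]
  · rw [← hw1]
    exact (Fintype.sum_of_injective e e.injective _ _ hext0 fun i => (hext i).symm).symm
  · rw [← hwz]
    refine (Fintype.sum_of_injective e e.injective _ _ (fun j hj => ?_) fun i => ?_).symm
    · rw [hext0 j hj, zero_smul]
    · simp only [hext, hinv, hx]

/-- Among `n + 1` vectors in `ℝⁿ`, up to signs, the origin is a convex combination. -/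
theorem exists_sign_zero_mem_convexHull {n : ℕ} (v : Fin (n + 1) → EuclideanSpace ℝ (Fin n)) :
    ∃ s : Fin (n + 1) → Prop, ∀ u : Fin (n + 1) → EuclideanSpace ℝ (Fin n),
      (∀ i, s i → u i = v i) → (∀ i, ¬ s i → u i = -v i) →
        (0 : EuclideanSpace ℝ (Fin n)) ∈ convexHull ℝ (Set.range u) := by
  have hdep : ¬ LinearIndependent ℝ v := by
    intro h
    have := h.fintype_card_le_finrank
    rw [finrank_euclideanSpace_fin, Fintype.card_fin] at this
    omega
  obtain ⟨c, hc, i₀, hi₀⟩ := Fintype.not_linearIndependent_iff.mp hdep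
  -- The signs are those of the coefficients of a linear dependence, so `|c i|`, once normalized,
  -- are convex weights annihilating `u`.
  refine ⟨fun i => 0 ≤ c i, fun u hpos hneg => ?_⟩
  have hu : ∀ i, |c i| • u i = c i • v i := by
    intro i
    by_cases h : 0 ≤ c i
    · rw [abs_of_nonneg h, hpos i h]
    · rw [abs_of_neg (not_le.mp h), hneg i h, neg_smul_neg]
  have hsum : 0 < ∑ i, |c i| :=
    Finset.sum_pos' (fun i _ => abs_nonneg _) ⟨i₀, Finset.mem_univ _, abs_pos.mpr hi₀⟩
  have hmem := Finset.centerMass_mem_convexHull (R := ℝ) Finset.univ (w := fun i => |c i|)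
    (z := u) (s := Set.range u) (fun i _ => abs_nonneg _) hsum fun i _ => Set.mem_range_self i
  have h0 : Finset.univ.centerMass (fun i => |c i|) u = 0 := by
    rw [Finset.centerMass, Finset.sum_congr rfl fun i _ => hu i, hc, smul_zero]
  rwa [h0] at hmem

/-! ### The infimum defining the Carathéodory number is attained for each map -/

theorem bddBelow_caratheodoryNumber (n : ℕ) (X : Type*) [MetricSpace X] [InvolutiveNeg X] :
    BddBelow {t : ℝ | 0 ≤ t ∧ ∀ f : X → EuclideanSpace ℝ (Fin n), Continuous f →
      Function.Odd f → ∃ A : Set X, DiamLE A t ∧ 0 ∈ convexHull ℝ (f '' A)} :=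
  ⟨0, fun _ ht => ht.1⟩

/-- A bound on all distances is admissible in the definition of the Carathéodory number: a pair of
opposite points does it. -/
theorem mem_caratheodoryNumber_set_of_dist_le (n : ℕ) {X : Type*} [MetricSpace X]
    [InvolutiveNeg X] [Nonempty X] {T : ℝ} (hT : ∀ x y : X, dist x y ≤ T) :
    T ∈ {t : ℝ | 0 ≤ t ∧ ∀ f : X → EuclideanSpace ℝ (Fin n), Continuous f →
      Function.Odd f → ∃ A : Set X, DiamLE A t ∧ 0 ∈ convexHull ℝ (f '' A)} := by
  obtain ⟨x₀⟩ := ‹Nonempty X›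
  refine ⟨dist_nonneg.trans (hT x₀ x₀), fun f _ hf => ⟨{x₀, -x₀}, fun x _ y _ => hT x y, ?_⟩⟩
  rw [Set.image_pair, convexHull_pair, hf x₀]
  exact ⟨1 / 2, 1 / 2, by norm_num, by norm_num, by norm_num, by simp⟩

/-- On a compact space, an odd map has a zero convex combination over a set of diameter at most
the Carathéodory number. -/
theorem exists_convexCombination_dist_le_caratheodoryNumber {X : Type*} [MetricSpace X]
    [InvolutiveNeg X] [CompactSpace X] {n : ℕ} {T : ℝ} (hT : ∀ x y : X, dist x y ≤ T)
    [Nonempty X] {g : X → EuclideanSpace ℝ (Fin n)} (hg : Continuous g) (hodd : Function.Odd g) :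
    ∃ (x : Fin (n + 1) → X) (w : Fin (n + 1) → ℝ), w ∈ stdSimplex ℝ (Fin (n + 1)) ∧
      ∑ i, w i • g (x i) = 0 ∧ ∀ i j, dist (x i) (x j) ≤ caratheodoryNumber n X := by
  -- `K` collects the vanishing convex combinations of `n + 1` values of `g`, and `D` below is the
  -- diameter of the points involved. A minimizer of `D` on `K` lies below every admissible `t`,
  -- hence below their infimum.
  let K : Set ((Fin (n + 1) → X) × (Fin (n + 1) → ℝ)) :=
    (Set.univ ×ˢ stdSimplex ℝ (Fin (n + 1))) ∩ {p | ∑ i, p.2 i • g (p.1 i) = 0}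
  have hK : IsCompact K :=
    (isCompact_univ.prod (isCompact_stdSimplex ℝ (Fin (n + 1)))).inter_right
      (isClosed_eq (by fun_prop) continuous_const)
  let D : (Fin (n + 1) → X) × (Fin (n + 1) → ℝ) → ℝ := fun p =>
    (Finset.univ : Finset (Fin (n + 1) × Fin (n + 1))).sup' Finset.univ_nonempty
      fun q => dist (p.1 q.1) (p.1 q.2)
  have hD : Continuous D := Continuous.finset_sup'_apply _ fun q _ => by fun_prop
  have hle : ∀ A : Set X, ∀ t, DiamLE A t → (0 : EuclideanSpace ℝ (Fin n)) ∈
      convexHull ℝ (g '' A) → ∃ p ∈ K, D p ≤ t := by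
    intro A t hA h0
    obtain ⟨x, w, hxA, hw, hwx⟩ := exists_fin_convexCombination_of_mem_convexHull_image h0
    exact ⟨(x, w), ⟨⟨Set.mem_univ _, hw⟩, hwx⟩,
      Finset.sup'_le _ _ fun q _ => hA _ (hxA _) _ (hxA _)⟩
  have hTmem := mem_caratheodoryNumber_set_of_dist_le n hT
  have hKne : K.Nonempty := by
    obtain ⟨A, hA, h0⟩ := hTmem.2 g hg hodd
    obtain ⟨p, hp, -⟩ := hle A T hA h0
    exact ⟨p, hp⟩
  obtain ⟨p, hp, hmin⟩ := hK.exists_isMinOn hKne hD.continuousOn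
  have hpc : D p ≤ caratheodoryNumber n X := by
    refine le_csInf ⟨T, hTmem⟩ fun t ht => ?_
    obtain ⟨A, hA, h0⟩ := ht.2 g hg hodd
    obtain ⟨q, hq, hqt⟩ := hle A t hA h0
    exact (hmin hq).trans hqt
  exact ⟨p.1, p.2, hp.1.2, hp.2, fun i j => (Finset.le_sup'
    (fun q : Fin (n + 1) × Fin (n + 1) => dist (p.1 q.1) (p.1 q.2)) (Finset.mem_univ (i, j))).trans
      hpc⟩

/-! ### The sphere and projective space -/

theorem GeoSphere.dist_le_pi {d : ℕ} (x y : GeoSphere d) : dist x y ≤ Real.pi :=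
  InnerProductGeometry.angle_le_pi _ _

instance GeoSphere.instNonempty (d : ℕ) : Nonempty (GeoSphere d) :=
  (NormedSpace.sphere_nonempty (E := EuclideanSpace ℝ (Fin (d + 1)))).mpr zero_le_one |>.to_subtype

/-- A unit vector as a point of the sphere with its angular metric. -/
def GeoSphere.ofSphere {d : ℕ} (x : Metric.sphere (0 : EuclideanSpace ℝ (Fin (d + 1))) 1) :
    GeoSphere d := x

/-- The Euclidean topology on the sphere is at least as fine as that of the angular metric. -/
theorem GeoSphere.continuous_ofSphere (d : ℕ) : Continuous (GeoSphere.ofSphere (d := d)) := by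
  rw [continuous_iff_continuousAt]
  intro x
  rw [ContinuousAt, tendsto_iff_dist_tendsto_zero]
  -- The angle is continuous only at pairs of nonzero vectors.
  have hne : (x : EuclideanSpace ℝ (Fin (d + 1))) ≠ 0 := ne_zero_of_mem_unit_sphere x
  have hc : ContinuousAt (fun y : Metric.sphere (0 : EuclideanSpace ℝ (Fin (d + 1))) 1 =>
      InnerProductGeometry.angle (y : EuclideanSpace ℝ (Fin (d + 1))) x) x :=
    ContinuousAt.comp (f := fun y : Metric.sphere (0 : EuclideanSpace ℝ (Fin (d + 1))) 1 =>
        ((y : EuclideanSpace ℝ (Fin (d + 1))), (x : EuclideanSpace ℝ (Fin (d + 1)))))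
      (InnerProductGeometry.continuousAt_angle hne hne) (by fun_prop)
  rw [ContinuousAt, InnerProductGeometry.angle_self hne] at hc
  exact hc

instance GeoSphere.instCompactSpace (d : ℕ) : CompactSpace (GeoSphere d) :=
  Function.Surjective.compactSpace (GeoSphere.continuous_ofSphere d) fun x => ⟨x, rfl⟩

theorem GeoSphere.continuous_neg (d : ℕ) : Continuous (fun x : GeoSphere d => -x) :=
  (Isometry.of_dist_eq fun x y => by
    rw [GeoSphere.dist_neg_left, GeoSphere.dist_neg_right, sub_sub_cancel]).continuous

theorem RealProj.dist_mk {d : ℕ} (x y : GeoSphere d) :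
    dist (α := RealProj d) (Quotient.mk (GeoSphere.antipodalSetoid d) x)
      (Quotient.mk (GeoSphere.antipodalSetoid d) y) = min (dist x y) (dist x (-y)) := rfl

theorem GeoSphere.caratheodoryNumber_le_pi (n d : ℕ) :
    caratheodoryNumber n (GeoSphere d) ≤ Real.pi :=
  csInf_le (bddBelow_caratheodoryNumber n _)
    (mem_caratheodoryNumber_set_of_dist_le n GeoSphere.dist_le_pi)

/-- A projective code of `n + 1 ≥ 2` points at distance `ε` bounds the Carathéodory number of the
sphere by `π - ε`. -/
theorem GeoSphere.caratheodoryNumber_le_of_code {n d : ℕ} (hn : 0 < n) {ε : ℝ}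
    (p : Fin (n + 1) → RealProj d) (hp : ∀ i j, i ≠ j → ε ≤ dist (p i) (p j)) :
    caratheodoryNumber n (GeoSphere d) ≤ Real.pi - ε := by
  choose x hx using fun i => Quotient.exists_rep (p i)
  have hcode : ∀ i j, i ≠ j → ε ≤ dist (x i) (x j) ∧ ε ≤ dist (x i) (-x j) := by
    intro i j hij
    have h := hp i j hij
    rw [← hx i, ← hx j, RealProj.dist_mk] at h
    exact le_min_iff.mp h
  -- Admissible `t` must be nonnegative. Since `n > 0` there are two distinct code points, and their
  -- angle is at most `π`.
  have hε : 0 ≤ Real.pi - ε := by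
    have h01 : (0 : Fin (n + 1)) ≠ Fin.last n := by
      rw [Ne, Fin.ext_iff, Fin.val_zero, Fin.val_last]
      omega
    have h := (hcode 0 (Fin.last n) h01).1
    have h' := GeoSphere.dist_le_pi (x 0) (x (Fin.last n))
    linarith
  refine csInf_le (bddBelow_caratheodoryNumber n _) ⟨hε, fun f _ hf => ?_⟩
  classical
  obtain ⟨s, hs⟩ := exists_sign_zero_mem_convexHull fun i => f (x i)
  let z : Fin (n + 1) → GeoSphere d := fun i => if s i then x i else -x i
  refine ⟨Set.range z, ?_, ?_⟩
  · rintro _ ⟨i, rfl⟩ _ ⟨j, rfl⟩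
    by_cases hij : i = j
    · subst hij
      rwa [dist_self]
    · obtain ⟨h1, h2⟩ := hcode i j hij
      -- Now `ε ≤ α` and `ε ≤ π - α` for `α = dist (x i) (x j)`. Every choice of signs gives
      -- distance `α` or `π - α`, so at most `π - ε`.
      rw [GeoSphere.dist_neg_right] at h2
      by_cases hi : s i <;> by_cases hj : s j <;>
        simp only [z, hi, hj, if_true, if_false, GeoSphere.dist_neg_left,
          GeoSphere.dist_neg_right] <;> linarith
  · rw [← Set.range_comp]
    refine hs _ (fun i hi => ?_) fun i hi => ?_
    · simp [z, hi]
    · simp [z, hi, hf (x i)]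

theorem GeoSphere.caratheodoryNumber_le_pi_sub_packingDist {n : ℕ} (hn : 0 < n) (d : ℕ) :
    caratheodoryNumber n (GeoSphere d) ≤ Real.pi - packingDist (n + 1) (RealProj d) := by
  have h : packingDist (n + 1) (RealProj d) ≤ Real.pi - caratheodoryNumber n (GeoSphere d) := by
    -- The nonnegativity of the bound covers the case without any code, such as `d = 0`, where the
    -- supremum of the empty set is `0`.
    refine Real.sSup_le ?_ (sub_nonneg.mpr (GeoSphere.caratheodoryNumber_le_pi n d))
    rintro ε ⟨-, p, hp⟩
    have := GeoSphere.caratheodoryNumber_le_of_code hn p hp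
    linarith
  linarith

/-! ### Finitely supported probability measures -/

/-- The measure `∑ i, w i • δ_{x i}`. -/
noncomputable def atomicMeasure {X ι : Type*} [MeasurableSpace X] [Fintype ι] (x : ι → X) (w : ι → ℝ) :
    Measure X :=
  ∑ i, ENNReal.ofReal (w i) • Measure.dirac (x i)

theorem isProbabilityMeasure_atomicMeasure {X ι : Type*} [MeasurableSpace X] [Fintype ι]
    (x : ι → X) {w : ι → ℝ} (hw : w ∈ stdSimplex ℝ ι) :
    IsProbabilityMeasure (atomicMeasure x w) := by
  refine ⟨?_⟩
  simp only [atomicMeasure, Measure.finsetSum_apply, Measure.smul_apply, measure_univ,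
    smul_eq_mul, mul_one]
  rw [← ENNReal.ofReal_sum_of_nonneg fun i _ => hw.1 i, hw.2, ENNReal.ofReal_one]

/-- The range is finite, hence closed, and its complement is null. Only an inclusion is claimed,
since points of weight zero need not lie in the support. -/
theorem support_atomicMeasure_subset {X ι : Type*} [TopologicalSpace X] [T1Space X]
    [MeasurableSpace X] [OpensMeasurableSpace X] [Fintype ι] (x : ι → X) (w : ι → ℝ) :
    (atomicMeasure x w).support ⊆ Set.range x := by
  have hcl : IsClosed (Set.range x) := (Set.finite_range x).isClosed
  refine Measure.support_subset_of_isClosed hcl ?_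
  rw [mem_ae_iff, atomicMeasure, Measure.finsetSum_apply]
  refine Finset.sum_eq_zero fun i _ => ?_
  rw [Measure.smul_apply, Measure.dirac_apply' _ hcl.isOpen_compl.measurableSet]
  simp

/-- Measurable singletons make every function integrable against a Dirac mass, so `f` needs no
regularity. -/
theorem integral_atomicMeasure {X ι E : Type*} [MeasurableSpace X] [MeasurableSingletonClass X]
    [NormedAddCommGroup E] [NormedSpace ℝ E] [CompleteSpace E] [Fintype ι] (x : ι → X)
    {w : ι → ℝ} (hw : ∀ i, 0 ≤ w i) (f : X → E) :
    ∫ a, f a ∂(atomicMeasure x w) = ∑ i, w i • f (x i) := by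
  rw [atomicMeasure, integral_finsetSum_measure fun i _ =>
    (integrable_dirac (by simp)).smul_measure ENNReal.ofReal_ne_top]
  refine Finset.sum_congr rfl fun i _ => ?_
  rw [integral_smul_measure, integral_dirac, ENNReal.toReal_ofReal (hw i)]

/-! ### Antipodal coincidences and the main theorem -/

/-- A map on the sphere takes the same value on a convex combination of points of a set of diameter
at most `δ` and on the same combination of their antipodes. -/
theorem exists_common_convexCombination_antipodal {d n : ℕ} {δ : ℝ}
    (hδ : caratheodoryNumber n (GeoSphere d) ≤ δ) {f : GeoSphere d → EuclideanSpace ℝ (Fin n)}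
    (hf : Continuous f) :
    ∃ (x : Fin (n + 1) → GeoSphere d) (w : Fin (n + 1) → ℝ), w ∈ stdSimplex ℝ (Fin (n + 1)) ∧
      ∑ i, w i • f (-x i) = ∑ i, w i • f (x i) ∧ DiamLE (Set.range x) δ := by
  have hodd : Function.Odd fun x => f x - f (-x) := fun x => by
    show f (-x) - f (- -x) = -(f x - f (-x))
    rw [neg_neg, neg_sub]
  obtain ⟨x, w, hw, h0, hx⟩ := exists_convexCombination_dist_le_caratheodoryNumber
    (g := fun x => f x - f (-x))
    GeoSphere.dist_le_pi (hf.sub (hf.comp (GeoSphere.continuous_neg d))) hodd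
  refine ⟨x, w, hw, ?_, ?_⟩
  · simp only [smul_sub, Finset.sum_sub_distrib] at h0
    exact (sub_eq_zero.mp h0).symm
  · rintro _ ⟨i, rfl⟩ _ ⟨j, rfl⟩
    exact (hx i j).trans hδ

end ProjectiveCode

theorem mainTheorem6 (d n : ℕ) (hd : 0 < d) (hn : 0 < n) (δ : ℝ) :
    (Real.pi - ProjectiveCode.packingDist (n + 1) (ProjectiveCode.RealProj d) ≤ δ →
      ProjectiveCode.caratheodoryNumber n (ProjectiveCode.GeoSphere d) ≤ δ) ∧
    (ProjectiveCode.caratheodoryNumber n (ProjectiveCode.GeoSphere d) ≤ δ →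
      ∀ f : ProjectiveCode.GeoSphere d → EuclideanSpace ℝ (Fin n), Continuous f →
        ∃ X : Set (ProjectiveCode.GeoSphere d), ProjectiveCode.DiamLE X δ ∧
          ∃ y ∈ convexHull ℝ (f '' X) ∩ convexHull ℝ (f '' (-X)),
            ∃ μ ∈ ProjectiveCode.thickening (ProjectiveCode.GeoSphere d) δ,
              (μ : MeasureTheory.Measure (ProjectiveCode.GeoSphere d)).support ⊆ X ∧
              ∫ x, f x ∂(μ : MeasureTheory.Measure (ProjectiveCode.GeoSphere d)) = y ∧
              ∫ x, f (-x) ∂(μ : MeasureTheory.Measure (ProjectiveCode.GeoSphere d)) = y) := by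
  open ProjectiveCode in
  refine ⟨(GeoSphere.caratheodoryNumber_le_pi_sub_packingDist hn d).trans, fun hδ f hf => ?_⟩
  obtain ⟨x, w, hw, hfx, hx⟩ := exists_common_convexCombination_antipodal hδ hf
  have hsupp := support_atomicMeasure_subset x w
  -- One family `x` with weights `w` serves for everything: its range is `X`, and the atomic measure
  -- is `μ`.
  refine ⟨Set.range x, hx, ∑ i, w i • f (x i), ⟨?_, ?_⟩,
    ⟨atomicMeasure x w, isProbabilityMeasure_atomicMeasure x hw⟩,
    ⟨(Set.finite_range x).subset hsupp, fun a ha b hb => hx a (hsupp ha) b (hsupp hb)⟩, hsupp,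
    integral_atomicMeasure x hw.1 f, ?_⟩
  · exact (convex_convexHull ℝ _).sum_mem (fun i _ => hw.1 i) hw.2 fun i _ =>
      subset_convexHull ℝ _ ⟨x i, Set.mem_range_self i, rfl⟩
  · rw [← hfx]
    exact (convex_convexHull ℝ _).sum_mem (fun i _ => hw.1 i) hw.2 fun i _ =>
      subset_convexHull ℝ _ ⟨-x i, by simp, rfl⟩
  · exact (integral_atomicMeasure x hw.1 fun a => f (-a)).trans hfx
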